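/- For a permutation $p=p_1p_2\cdots p_n$ of $\{1,\dots,n\}$, the binary search tree (decreasing binary tree) $T(p)$ is the labeled binary tree whose root carries the largest entry $n$ of $p$, and whose left and right subtrees are the trees defined in the same way, recursively, by the words $p'$ and $p''$ that stand in $p$ to the left and to the right of $n$ (an empty word gives the empty tree, that is, a missing child). The map $p\mapsto T(p)$ is a bijection from the $n!$ permutations of $\{1,\dots,n\}$ onto the binary search trees on $n$ vertices. A leaf is a vertex without children, and a vertex $v$ is at level $k$ if the shortest path that descends from $v$ to a leaf has exactly $k-1$ edges (so the leaves are the vertices at level $1$). Theorem. Let $k\ge 1$, and let $a_{n,k}$ be the total number of vertices at level $k$ in all binary search trees on $n$ vertices. Then there is a rational constant $c_k$ such that $$\lim_{n\to\infty}\frac{a_{n,k}}{(n+1)!}=c_k .$$ Equivalently, the probability that a uniformly random vertex of a uniformly random binary search tree on $n$ vertices is at level $k$ converges to $c_k$ as $n\to\infty$. -/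

import Mathlib

open Filter Topology
open scoped Nat

namespace SearchTree

/-- The binary search tree (decreasing binary tree) `T(p)` of a word `p` of natural numbers:
the root carries the largest entry `m` of `p`, and its left and right subtrees are the trees of
the parts of `p` to the left and to the right of (the first occurrence of) `m`.
`BinaryTree.nil` is the empty tree, so a missing child is a `nil` child. -/
def ofList (p : List ℕ) : BinaryTree ℕ :=
  if h : p = [] then .nil
  else
    .node (p.max h) (ofList (p.take (p.idxOf (p.max h))))
      (ofList (p.drop (p.idxOf (p.max h) + 1)))
termination_by p.length
decreasing_by
  all_goals
    have hlt := List.idxOf_lt_length_of_mem (List.max_mem h)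
    simp only [List.length_take, List.length_drop]
    omega

/-- The one-line notation `p₁ p₂ ⋯ pₙ` of a permutation of `n` letters, with entries `1, …, n`. -/
def word {n : ℕ} (p : Equiv.Perm (Fin n)) : List ℕ :=
  List.ofFn fun i => (p i : ℕ) + 1

/-- The binary search tree `T(p)` of a permutation `p`. -/
def ofPerm {n : ℕ} (p : Equiv.Perm (Fin n)) : BinaryTree ℕ :=
  ofList (word p)

/-- The vertices of a binary tree. A vertex is named by the path that leads from the root to it:
`false` is a step to the left child, `true` a step to the right child, and `[]` is the root. -/
def vertices : BinaryTree ℕ → Finset (List Bool)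
  | .nil => ∅
  | .node _ l r =>
    insert [] ((vertices l).image (List.cons false) ∪ (vertices r).image (List.cons true))

/-- A leaf is a vertex without children. -/
def IsLeaf (t : BinaryTree ℕ) (v : List Bool) : Prop :=
  v ∈ vertices t ∧ ∀ b : Bool, v ++ [b] ∉ vertices t

/-- The vertex `v` is at level `k` if `k - 1` is the smallest number of edges of a path that
descends from `v` to a leaf. The descendants of `v` are the vertices `v ++ w`, at distance
`w.length` from `v`; for `w = []` this is `v` itself, so the leaves are the vertices at level 1. -/
def AtLevel (t : BinaryTree ℕ) (k : ℕ) (v : List Bool) : Prop :=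
  IsLeast {m : ℕ | ∃ w : List Bool, IsLeaf t (v ++ w) ∧ m = w.length + 1} k

open Classical in
/-- The number of vertices at level `k` in the tree `t`. -/
noncomputable def levelCount (t : BinaryTree ℕ) (k : ℕ) : ℕ :=
  ((vertices t).filter (AtLevel t k)).card

/-- `a_{n,k}`: the total number of vertices at level `k` in all binary search trees on `n`
vertices, that is, in the trees `T(p)` of all permutations `p` of `n` letters
(distinct permutations have distinct trees, see `ofPerm_injective`). -/
noncomputable def totalLevelCount (n k : ℕ) : ℕ :=
  ∑ p : Equiv.Perm (Fin n), levelCount (ofPerm p) k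

/-- The probability that a uniformly random vertex of a uniformly random binary search tree on
`n` vertices is at level `k`. -/
noncomputable def levelProb (n k : ℕ) : ℝ :=
  (∑ p : Equiv.Perm (Fin n),
    (levelCount (ofPerm p) k : ℝ) / ((vertices (ofPerm p)).card : ℝ)) /
    (Fintype.card (Equiv.Perm (Fin n)) : ℝ)

/-- Reading a tree in in-order: left subtree, root, right subtree. -/
def inorder : BinaryTree ℕ → List ℕ
  | .nil => []
  | .node a l r => inorder l ++ a :: inorder r

theorem inorder_ofList (p : List ℕ) : inorder (ofList p) = p := by
  induction hn : p.length using Nat.strong_induction_on generalizing p with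
  | _ n ih =>
    subst hn
    rw [ofList]
    split_ifs with h
    · simp [inorder, h]
    · have hlt := List.idxOf_lt_length_of_mem (List.max_mem h)
      rw [inorder, ih _ (by simp only [List.length_take]; omega) _ rfl,
        ih _ (by simp only [List.length_drop]; omega) _ rfl]
      conv_rhs => rw [← List.take_append_drop (p.idxOf (p.max h)) p,
        List.drop_eq_getElem_cons hlt, List.getElem_idxOf hlt]

/-- The tree determines the permutation. -/
theorem ofPerm_injective (n : ℕ) :
    Function.Injective (ofPerm : Equiv.Perm (Fin n) → BinaryTree ℕ) := by
  intro p q h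
  have h2 : word p = word q := by
    rw [← inorder_ofList (word p), ← inorder_ofList (word q)]
    exact congrArg inorder h
  have h3 := List.ofFn_injective h2
  ext i
  have h4 := congrFun h3 i
  simpa using h4

end SearchTree

/-! Exponential generating functions turn the splitting of a tree at its root into differential
equations. Let `G_k` count the trees all of whose leaves have depth at least `k`. Then `G_0 =
1/(1-x)` and `G_{k+1}' = G_k^2 - 1`, where the `1` removes the one-vertex tree. The root is at level
`k+1` exactly for the trees counted by `R = G_k - G_{k+1}`, so the series `F` of the numbers
`a_{n,k+1}/n!` satisfies `F' = R' + 2F/(1-x)`, `F(0) = 0`.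

Let `A` be the algebra of polynomials in `1-x` and `log(1-x)` over the rationals. It is closed under
integration, and so each `G_k - 1/(1-x)` lies in `A` (`exists_mem_logAlgebra_of_derivative_eq`).
Solving for `F` (`exists_total_series`) gives `F = R + 2q/(1-x)^2 + 2a/(1-x)` with `q` rational and
`R`, `a` in `A`. Coefficients of elements of `A` tend to `0`, so the coefficient of `x^n` in `F` is
`2q(n+1) + o(n)`, and the limit is `2q`. -/

namespace SearchTree

open PowerSeries

/-! ### Integration in the algebra of polynomials in `1 - X` and `log (1 - X)` -/

/-- The geometric series `1 / (1 - X)`. -/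
noncomputable def geomSeries : ℚ⟦X⟧ := mk 1

/-- The formal logarithm `log (1 - X)`. -/
noncomputable def logSeries : ℚ⟦X⟧ := mk fun n => -(n : ℚ)⁻¹

/-- The algebra of polynomials in `1 - X` and `log (1 - X)`. -/
noncomputable def logAlgebra : Subalgebra ℚ ℚ⟦X⟧ := Algebra.adjoin ℚ {1 - X, logSeries}

theorem geomSeries_mul : geomSeries * (1 - X) = 1 := mk_one_mul_one_sub_eq_one ℚ

theorem coeff_geomSeries (n : ℕ) : coeff n geomSeries = 1 := by simp [geomSeries]

theorem coeff_geomSeries_mul (f : ℚ⟦X⟧) (n : ℕ) :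
    coeff n (geomSeries * f) = ∑ i ∈ Finset.range (n + 1), coeff i f := by
  rw [mul_comm, coeff_mul, Finset.Nat.sum_antidiagonal_eq_sum_range_succ_mk]
  simp [coeff_geomSeries]

theorem derivative_one_sub_X : derivative ℚ (1 - X : ℚ⟦X⟧) = -1 := by
  rw [map_sub, derivative_one, derivative_X, zero_sub]

theorem derivative_geomSeries : derivative ℚ geomSeries = geomSeries ^ 2 := by
  have h := congrArg (derivative ℚ) geomSeries_mul
  rw [Derivation.leibniz, derivative_one_sub_X, derivative_one, smul_eq_mul, smul_eq_mul] at h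
  linear_combination geomSeries * h - derivative ℚ geomSeries * geomSeries_mul

theorem derivative_logSeries : derivative ℚ logSeries = -geomSeries := by
  ext n
  rw [coeff_derivative, map_neg, coeff_geomSeries, logSeries, coeff_mk]
  have : (n : ℚ) + 1 ≠ 0 := by positivity
  push_cast
  field_simp

theorem one_sub_X_mem : (1 - X : ℚ⟦X⟧) ∈ logAlgebra :=
  Algebra.subset_adjoin (by simp)

theorem logSeries_mem : logSeries ∈ logAlgebra :=
  Algebra.subset_adjoin (by simp)

theorem C_mem (q : ℚ) : (C q : ℚ⟦X⟧) ∈ logAlgebra :=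
  logAlgebra.algebraMap_mem q

theorem logAlgebra_induction {p : ℚ⟦X⟧ → Prop}
    (monomial : ∀ i j : ℕ, p ((1 - X) ^ i * logSeries ^ j))
    (add : ∀ f g, p f → p g → p (f + g)) (smul : ∀ (q : ℚ) f, p f → p (q • f))
    {f : ℚ⟦X⟧} (hf : f ∈ logAlgebra) : p f := by
  have h : f ∈ Submodule.span ℚ
      (Submonoid.closure ({1 - X, logSeries} : Set ℚ⟦X⟧) : Set ℚ⟦X⟧) := by
    rw [← Algebra.adjoin_eq_span]; exact hf
  induction h using Submodule.span_induction with
  | mem x hx =>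
    obtain ⟨i, j, rfl⟩ := (Submonoid.mem_closure_pair _ _ _).1 hx
    exact monomial i j
  | zero => simpa using smul 0 _ (monomial 0 0)
  | add f g hf' hg' h1 h2 =>
    rw [← Algebra.adjoin_eq_span] at hf' hg'
    exact add _ _ (h1 hf') (h2 hg')
  | smul q f hf' h1 =>
    rw [← Algebra.adjoin_eq_span] at hf'
    exact smul _ _ (h1 hf')

theorem C_inv_mul_natCast_add_one (i : ℕ) :
    (C (i + 1 : ℚ)⁻¹ : ℚ⟦X⟧) * ((i : ℚ⟦X⟧) + 1) = 1 := by
  have h : ((i : ℚ⟦X⟧) + 1) = C (i + 1 : ℚ) := by simp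
  rw [h, ← map_mul, inv_mul_cancel₀ (by positivity), map_one]

/-- Integration by parts, lowering the power of the logarithm. The factor `1 - X` of the
antiderivative matters: it cancels one pole when `exists_total_series` divides by `(1 - X)^2`. -/
theorem exists_antiderivative_monomial (i j : ℕ) :
    ∃ a ∈ logAlgebra, derivative ℚ ((1 - X) * a) = (1 - X) ^ i * logSeries ^ j := by
  induction j with
  | zero =>
    refine ⟨(-(i + 1 : ℚ)⁻¹) • (1 - X) ^ i,
      logAlgebra.smul_mem (pow_mem one_sub_X_mem _) _, ?_⟩
    rw [mul_smul_comm, Derivation.map_smul, ← pow_succ', derivative_pow, derivative_one_sub_X, pow_zero]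
    have h' := C_inv_mul_natCast_add_one i
    rw [smul_eq_C_mul, map_neg]
    push_cast
    linear_combination (1 - X) ^ i * h'
  | succ j ih =>
    obtain ⟨a, ha, hd⟩ := ih
    refine ⟨(-(i + 1 : ℚ)⁻¹) • ((1 - X) ^ i * logSeries ^ (j + 1) + (j + 1 : ℚ) • a),
      logAlgebra.smul_mem (add_mem (mul_mem (pow_mem one_sub_X_mem _) (pow_mem logSeries_mem _))
        (logAlgebra.smul_mem ha _)) _, ?_⟩
    rw [mul_smul_comm, Derivation.map_smul, mul_add, map_add, mul_smul_comm, Derivation.map_smul, hd, ← mul_assoc,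
      ← pow_succ', Derivation.leibniz, derivative_pow, derivative_pow, derivative_one_sub_X,
      derivative_logSeries]
    have h' := C_inv_mul_natCast_add_one i
    simp only [smul_eq_C_mul, map_neg, smul_eq_mul, map_add, map_natCast, map_one]
    push_cast
    simp only [pow_succ]
    linear_combination (1 - X) ^ i * logSeries ^ j * logSeries * h' +
      C (i + 1 : ℚ)⁻¹ * (j + 1) * (1 - X) ^ i * logSeries ^ j * geomSeries_mul

theorem exists_antiderivative {f : ℚ⟦X⟧} (hf : f ∈ logAlgebra) :
    ∃ a ∈ logAlgebra, derivative ℚ ((1 - X) * a) = f := by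
  refine logAlgebra_induction (p := fun f => ∃ a ∈ logAlgebra, derivative ℚ ((1 - X) * a) = f) ?_ ?_ ?_ hf
  · intro i j
    exact exists_antiderivative_monomial i j
  · intro f g h1 h2
    obtain ⟨a, ha, rfl⟩ := h1
    obtain ⟨b, hb, rfl⟩ := h2
    exact ⟨a + b, add_mem ha hb, by rw [mul_add, map_add]⟩
  · intro q f h
    obtain ⟨a, ha, rfl⟩ := h
    exact ⟨q • a, logAlgebra.smul_mem ha _, by rw [mul_smul_comm, Derivation.map_smul]⟩

theorem exists_antiderivative_geomSeries_mul {f : ℚ⟦X⟧} (hf : f ∈ logAlgebra) :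
    ∃ a ∈ logAlgebra, derivative ℚ a = geomSeries * f := by
  refine logAlgebra_induction (p := fun f => ∃ a ∈ logAlgebra, derivative ℚ a = geomSeries * f) ?_ ?_ ?_ hf
  · intro i j
    cases i with
    | zero =>
      refine ⟨(-(j + 1 : ℚ)⁻¹) • logSeries ^ (j + 1),
        logAlgebra.smul_mem (pow_mem logSeries_mem _) _, ?_⟩
      have h' := C_inv_mul_natCast_add_one j
      rw [Derivation.map_smul, derivative_pow, derivative_logSeries, smul_eq_C_mul, map_neg,
        pow_zero]
      push_cast
      linear_combination geomSeries * logSeries ^ j * h'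
    | succ i =>
      obtain ⟨a, ha, hd⟩ := exists_antiderivative_monomial i j
      refine ⟨(1 - X) * a, mul_mem one_sub_X_mem ha, ?_⟩
      rw [hd, pow_succ]
      linear_combination -(1 - X) ^ i * logSeries ^ j * geomSeries_mul
  · intro f g h1 h2
    obtain ⟨a, ha, h1⟩ := h1
    obtain ⟨b, hb, h2⟩ := h2
    exact ⟨a + b, add_mem ha hb, by rw [mul_add, map_add, h1, h2]⟩
  · intro q f h
    obtain ⟨a, ha, h⟩ := h
    exact ⟨q • a, logAlgebra.smul_mem ha _, by rw [mul_smul_comm, Derivation.map_smul, h]⟩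

/-! ### Decay of coefficients -/

/-- Differentiating the power `j + 1` shows that its coefficients are, up to the factor `-(j + 1)`,
Cesàro means of the coefficients of the power `j`. -/
theorem tendsto_coeff_logSeries_pow (j : ℕ) :
    Tendsto (fun n => ((coeff n (logSeries ^ j) : ℚ) : ℝ)) atTop (𝓝 0) := by
  induction j with
  | zero =>
    refine tendsto_const_nhds.congr' ?_
    filter_upwards [eventually_ne_atTop 0] with n hn
    simp [coeff_one, hn]
  | succ j ih =>
    rw [← tendsto_add_atTop_iff_nat 1]
    have h := ((tendsto_add_atTop_iff_nat 1).2 ih.cesaro).const_mul (-(j + 1 : ℝ))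
    rw [mul_zero] at h
    refine h.congr fun n => ?_
    have hd := congrArg (coeff n) (derivative_pow logSeries (j + 1))
    rw [coeff_derivative, derivative_logSeries, Nat.add_sub_cancel,
      show ((j + 1 : ℕ) : ℚ⟦X⟧) * logSeries ^ j * -geomSeries =
        C (-(j + 1 : ℚ)) * (geomSeries * logSeries ^ j) by simp; ring,
      coeff_C_mul, coeff_geomSeries_mul] at hd
    have hd' : ((coeff (n + 1) (logSeries ^ (j + 1)) : ℚ) : ℝ) * (n + 1) =
        -(j + 1) * ∑ i ∈ Finset.range (n + 1), ((coeff i (logSeries ^ j) : ℚ) : ℝ) := by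
      exact_mod_cast hd
    have hn : (n + 1 : ℝ) ≠ 0 := by positivity
    push_cast
    field_simp
    linear_combination -hd'

theorem tendsto_coeff_of_mem_logAlgebra {f : ℚ⟦X⟧} (hf : f ∈ logAlgebra) :
    Tendsto (fun n => ((coeff n f : ℚ) : ℝ)) atTop (𝓝 0) := by
  refine logAlgebra_induction (p := fun f => Tendsto (fun n => ((coeff n f : ℚ) : ℝ)) atTop (𝓝 0)) ?_ ?_ ?_ hf
  · intro i j
    induction i with
    | zero => simpa using tendsto_coeff_logSeries_pow j
    | succ i ih =>
      -- Multiplication by `1 - X` takes differences of consecutive coefficients.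
      rw [← tendsto_add_atTop_iff_nat 1]
      have h := ((tendsto_add_atTop_iff_nat 1).2 ih).sub ih
      rw [sub_zero] at h
      refine h.congr fun n => ?_
      rw [pow_succ', mul_assoc, sub_mul, one_mul, map_sub, coeff_succ_X_mul]
      push_cast
      rfl
  · intro f g h1 h2
    simpa using h1.add h2
  · intro q f h
    simpa using h.const_mul (q : ℝ)

/-! ### The two differential equations -/

/-- With `p = G - geomSeries`, the right side is `geomSeries^2 + 2 * geomSeries * p + (p^2 - 1)`.
The first term integrates to `geomSeries`, the others within the algebra. -/
theorem exists_mem_logAlgebra_of_derivative_eq {G H : ℚ⟦X⟧}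
    (hG : G - geomSeries ∈ logAlgebra) (hH : derivative ℚ H = G * G - 1) :
    H - geomSeries ∈ logAlgebra := by
  set p := G - geomSeries with hp
  obtain ⟨b, hb, hbd⟩ := exists_antiderivative_geomSeries_mul hG
  obtain ⟨a, ha, had⟩ := exists_antiderivative (sub_mem (mul_mem hG hG) (one_mem _))
  have hmem : b + b + (1 - X) * a ∈ logAlgebra :=
    add_mem (add_mem hb hb) (mul_mem one_sub_X_mem ha)
  have h : H - geomSeries =
      (b + b + (1 - X) * a) + C (constantCoeff (H - geomSeries - (b + b + (1 - X) * a))) := by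
    apply derivative.ext
    · rw [map_sub, hH, map_add, map_add, map_add, hbd, had, derivative_C, derivative_geomSeries,
        hp]
      ring
    · simp
  rw [h]
  exact add_mem hmem (C_mem _)

/-- The solution of the differential equation for the total number of vertices
with a given property of the subtree that they span. -/
theorem exists_total_series {R : ℚ⟦X⟧} (hR : R ∈ logAlgebra) (h0 : constantCoeff R = 0) :
    ∃ F : ℚ⟦X⟧, constantCoeff F = 0 ∧
      derivative ℚ F = derivative ℚ R + 2 * (geomSeries * F) ∧
      ∃ c : ℚ, Tendsto (fun n : ℕ => ((coeff n F : ℚ) : ℝ) / (n + 1)) atTop (𝓝 c) := by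
  obtain ⟨a, ha, hd⟩ := exists_antiderivative (mul_mem one_sub_X_mem hR)
  set q : ℚ := -constantCoeff a
  have hd' : derivative ℚ a = R + geomSeries * a := by
    rw [Derivation.leibniz, derivative_one_sub_X, smul_eq_mul, smul_eq_mul] at hd
    linear_combination geomSeries * hd - (derivative ℚ a - R) * geomSeries_mul
  have hU0 : constantCoeff geomSeries = 1 := by
    rw [← coeff_zero_eq_constantCoeff_apply, coeff_geomSeries]
  -- The integrating factor `(1 - X)^2` and integration by parts give this solution; `q` is the
  -- integration constant that makes `F` vanish at `0`.
  refine ⟨R + 2 * (C q * geomSeries ^ 2 + geomSeries * a), ?_, ?_, 2 * q, ?_⟩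
  · simp [h0, hU0, q]
  · rw [show (2 : ℚ⟦X⟧) = C 2 from (map_ofNat C 2).symm]
    simp only [map_add, Derivation.leibniz, smul_eq_mul, derivative_C, hd', derivative_geomSeries,
      derivative_pow]
    rw [show (C 2 : ℚ⟦X⟧) = 2 from map_ofNat C 2]
    push_cast
    ring
  · have h1 := (tendsto_coeff_of_mem_logAlgebra hR).mul tendsto_one_div_add_atTop_nhds_zero_nat
    -- The coefficients of `geomSeries * a` are partial sums of a null sequence, hence `o(n)`.
    have h2 := ((tendsto_add_atTop_iff_nat 1).2
      (tendsto_coeff_of_mem_logAlgebra ha).cesaro).const_mul 2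
    have h3 := (h1.add h2).const_add (2 * q : ℝ)
    rw [mul_zero, mul_zero, add_zero, add_zero] at h3
    push_cast
    refine h3.congr fun n => ?_
    have hc : coeff n (R + 2 * (C q * geomSeries ^ 2 + geomSeries * a)) =
        coeff n R + 2 * (q * (n + 1) + ∑ i ∈ Finset.range (n + 1), coeff i a) := by
      rw [show (2 : ℚ⟦X⟧) = C 2 from (map_ofNat C 2).symm, map_add, coeff_C_mul, map_add, coeff_C_mul, pow_two,
        coeff_geomSeries_mul, coeff_geomSeries_mul]
      simp [coeff_geomSeries]
    rw [hc]
    have hn : (n + 1 : ℝ) ≠ 0 := by positivity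
    push_cast
    field_simp
    ring

/-! ### Sums over search trees and exponential generating functions -/

/-- The words in which each element of `s` occurs exactly once, and nothing else occurs. -/
def arrangements (s : Finset ℕ) : Finset (List ℕ) :=
  ⟨s.val.lists, Multiset.lists_nodup_finset s⟩

theorem mem_arrangements {s : Finset ℕ} {l : List ℕ} :
    l ∈ arrangements s ↔ l.Nodup ∧ l.toFinset = s := by
  rw [arrangements, Finset.mem_mk, Multiset.mem_lists_iff, Multiset.quot_mk_to_coe]
  constructor
  · intro h
    have hn : l.Nodup := by
      rw [← Multiset.coe_nodup, ← h]; exact s.nodup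
    refine ⟨hn, Finset.val_inj.1 ?_⟩
    rw [h, List.toFinset_val, hn.dedup]
  · rintro ⟨hn, rfl⟩
    rw [List.toFinset_val, hn.dedup]

theorem card_arrangements (s : Finset ℕ) : (arrangements s).card = s.card ! := by
  have h : s.val.lists = (s.toList.permutations : Multiset (List ℕ)) := by
    rw [← Multiset.lists_coe, Finset.coe_toList]
  calc (arrangements s).card = s.val.lists.card := rfl
    _ = s.card ! := by
      rw [h, Multiset.coe_card, List.length_permutations, Finset.length_toList]

theorem arrangements_empty : arrangements ∅ = {[]} := by
  ext l
  rw [mem_arrangements, List.toFinset_eq_empty_iff, Finset.mem_singleton]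
  constructor
  · exact fun h => h.2
  · rintro rfl
    exact ⟨List.nodup_nil, rfl⟩

theorem ofList_nil : ofList [] = .nil := by
  rw [ofList, dif_pos rfl]

theorem ofList_eq_node {p : List ℕ} (h : p ≠ []) :
    ofList p = .node (p.max h) (ofList (p.take (p.idxOf (p.max h))))
      (ofList (p.drop (p.idxOf (p.max h) + 1))) := by
  rw [ofList, dif_neg h]

theorem ofList_append_cons {m : ℕ} {l r : List ℕ} (hl : ∀ x ∈ l, x < m) (hr : ∀ x ∈ r, x < m) :
    ofList (l ++ m :: r) = .node m (ofList l) (ofList r) := by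
  have h : l ++ m :: r ≠ [] := by simp
  have hmax : (l ++ m :: r).max h = m := by
    apply le_antisymm
    · have := List.max_mem h
      rw [List.mem_append, List.mem_cons] at this
      rcases this with h1 | h1 | h1
      · exact (hl _ h1).le
      · exact h1.le
      · exact (hr _ h1).le
    · exact List.le_max_of_mem (by simp)
  have hidx : (l ++ m :: r).idxOf m = l.length := by
    rw [List.idxOf_append_of_notMem (fun hm => (hl m hm).ne rfl), List.idxOf_cons_self, add_zero]
  rw [ofList_eq_node h, hmax, hidx]
  simp

/-- The sum of a tree statistic over the search trees of all arrangements of `s`. -/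
noncomputable def treeSum (f : BinaryTree ℕ → ℚ) (s : Finset ℕ) : ℚ :=
  ∑ l ∈ arrangements s, f (ofList l)

/-- The sum of a statistic of pairs of trees over the search trees of all pairs of arrangements
of a subset of `s` and of its complement. -/
noncomputable def pairSum (f : BinaryTree ℕ → BinaryTree ℕ → ℚ) (s : Finset ℕ) : ℚ :=
  ∑ u ∈ s.powerset, ∑ l ∈ arrangements u, ∑ r ∈ arrangements (s \ u), f (ofList l) (ofList r)

theorem treeSum_empty (f : BinaryTree ℕ → ℚ) : treeSum f ∅ = f .nil := by
  rw [treeSum, arrangements_empty, Finset.sum_singleton, ofList_nil]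

theorem treeSum_const (c : ℚ) (s : Finset ℕ) : treeSum (fun _ => c) s = s.card ! * c := by
  rw [treeSum, Finset.sum_const, card_arrangements, nsmul_eq_mul]

/-- Cutting a word at its maximum `m` is a bijection onto triples `(u, l, r)`. Arbitrary label sets
are needed because `u` need not be an interval. -/
theorem treeSum_insert (f : BinaryTree ℕ → ℚ) {m : ℕ} {s : Finset ℕ} (hm : ∀ x ∈ s, x < m) :
    treeSum f (insert m s) = pairSum (fun l r => f (.node m l r)) s := by
  have hms : m ∉ s := fun h => (hm m h).ne rfl
  simp only [treeSum, pairSum, ← Finset.sum_product']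
  rw [Finset.sum_sigma']
  symm
  have hlt : ∀ {u : Finset ℕ} {l r : List ℕ}, u ⊆ s → l ∈ arrangements u →
      r ∈ arrangements (s \ u) → (∀ x ∈ l, x < m) ∧ ∀ x ∈ r, x < m := by
    intro u l r hu hl hr
    rw [mem_arrangements] at hl hr
    refine ⟨fun x hx => hm x (hu ?_), fun x hx => hm x (Finset.sdiff_subset (t := u) ?_)⟩
    · rw [← hl.2]; simpa using hx
    · rw [← hr.2]; simpa using hx
  refine Finset.sum_bij (fun x _ => x.2.1 ++ m :: x.2.2) ?_ ?_ ?_ ?_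
  · rintro ⟨u, l, r⟩ h
    simp only [Finset.mem_sigma, Finset.mem_powerset, Finset.mem_product] at h
    obtain ⟨hu, hl, hr⟩ := h
    obtain ⟨h1, h2⟩ := hlt hu hl hr
    rw [mem_arrangements] at hl hr ⊢
    refine ⟨?_, ?_⟩
    · rw [List.nodup_append, List.nodup_cons]
      refine ⟨hl.1, ⟨fun h => (h2 m h).ne rfl, hr.1⟩, ?_⟩
      rintro a ha b hb rfl
      rcases List.mem_cons.1 hb with rfl | hb
      · exact (h1 _ ha).ne rfl
      · have ha' : a ∈ u := by rw [← hl.2]; simpa using ha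
        have hb' : a ∈ s \ u := by rw [← hr.2]; simpa using hb
        exact (Finset.mem_sdiff.1 hb').2 ha'
    · rw [List.toFinset_append, List.toFinset_cons, hl.2, hr.2, Finset.union_insert,
        Finset.union_sdiff_of_subset hu]
  · rintro ⟨u, l, r⟩ h ⟨u', l', r'⟩ h' he
    simp only [Finset.mem_sigma, Finset.mem_powerset, Finset.mem_product] at h h' he
    obtain ⟨hu, hl, hr⟩ := h
    obtain ⟨hu', hl', hr'⟩ := h'
    have hml : m ∉ l := fun hx => ((hlt hu hl hr).1 m hx).ne rfl
    have hml' : m ∉ l' := fun hx => ((hlt hu' hl' hr').1 m hx).ne rfl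
    -- The position of `m` is the length of the left part.
    have hlen := congrArg (List.idxOf m) he
    rw [List.idxOf_append_of_notMem hml, List.idxOf_append_of_notMem hml', List.idxOf_cons_self,
      List.idxOf_cons_self, add_zero, add_zero] at hlen
    obtain ⟨rfl, he'⟩ := List.append_inj he hlen
    obtain rfl := List.tail_eq_of_cons_eq he'
    obtain rfl : u = u' := by
      rw [← (mem_arrangements.1 hl).2, ← (mem_arrangements.1 hl').2]
    rfl
  · intro p hp
    rw [mem_arrangements] at hp
    have hmp : m ∈ p := by
      rw [← List.mem_toFinset, hp.2]; exact Finset.mem_insert_self _ _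
    obtain ⟨l, r, rfl⟩ := List.append_of_mem hmp
    obtain ⟨hn, he⟩ := hp
    rw [List.nodup_append, List.nodup_cons] at hn
    obtain ⟨hnl, ⟨hmr, hnr⟩, hd⟩ := hn
    have hml : m ∉ l := fun h => hd m h m List.mem_cons_self rfl
    have hs : s = l.toFinset ∪ r.toFinset := by
      ext x
      have := Finset.ext_iff.1 he x
      simp only [List.toFinset_append, List.toFinset_cons, Finset.mem_union, Finset.mem_insert,
        List.mem_toFinset] at this ⊢
      by_cases hx : x = m
      · subst hx; tauto
      · tauto
    refine ⟨⟨l.toFinset, l, r⟩, ?_, rfl⟩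
    simp only [Finset.mem_sigma, Finset.mem_powerset, Finset.mem_product, mem_arrangements]
    refine ⟨hs ▸ Finset.subset_union_left, ⟨hnl, trivial⟩, hnr, ?_⟩
    ext x
    rw [hs, Finset.mem_sdiff, Finset.mem_union, List.mem_toFinset, List.mem_toFinset]
    constructor
    · exact fun hx => ⟨Or.inr hx, fun hx' => hd x hx' x (List.mem_cons_of_mem _ hx) rfl⟩
    · rintro ⟨h1 | h1, h2⟩
      · exact absurd h1 h2
      · exact h1
  · rintro ⟨u, l, r⟩ h
    simp only [Finset.mem_sigma, Finset.mem_powerset, Finset.mem_product] at h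
    obtain ⟨h1, h2⟩ := hlt h.1 h.2.1 h.2.2
    rw [ofList_append_cons h1 h2]

theorem pairSum_add (f g : BinaryTree ℕ → BinaryTree ℕ → ℚ) (s : Finset ℕ) :
    pairSum (fun l r => f l r + g l r) s = pairSum f s + pairSum g s := by
  simp only [pairSum, Finset.sum_add_distrib]

theorem pairSum_sub (f g : BinaryTree ℕ → BinaryTree ℕ → ℚ) (s : Finset ℕ) :
    pairSum (fun l r => f l r - g l r) s = pairSum f s - pairSum g s := by
  simp only [pairSum, Finset.sum_sub_distrib]

/-- Binomial convolution is the product of exponential generating functions. -/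
theorem pairSum_mul {f g : BinaryTree ℕ → ℚ} {F G : ℚ⟦X⟧} {s : Finset ℕ}
    (hf : ∀ u ⊆ s, treeSum f u = u.card ! * coeff u.card F)
    (hg : ∀ u ⊆ s, treeSum g u = u.card ! * coeff u.card G) :
    pairSum (fun l r => f l * g r) s = s.card ! * coeff s.card (F * G) := by
  set w : ℕ → ℚ := fun j => (j ! * coeff j F) * ((s.card - j) ! * coeff (s.card - j) G) with hw
  have h : ∀ u ∈ s.powerset,
      ∑ l ∈ arrangements u, ∑ r ∈ arrangements (s \ u), f (ofList l) * g (ofList r) =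
      w u.card := by
    intro u hu
    rw [Finset.mem_powerset] at hu
    have h1 := hf u hu
    have h2 := hg (s \ u) Finset.sdiff_subset
    rw [Finset.card_sdiff_of_subset hu] at h2
    rw [← Finset.sum_mul_sum]
    exact congrArg₂ (· * ·) h1 h2
  rw [pairSum, Finset.sum_congr rfl h, Finset.sum_powerset_apply_card w, coeff_mul,
    Finset.Nat.sum_antidiagonal_eq_sum_range_succ_mk, Finset.mul_sum]
  refine Finset.sum_congr rfl fun j hj => ?_
  rw [← Nat.choose_mul_factorial_mul_factorial (Nat.lt_succ_iff.1 (Finset.mem_range.1 hj)),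
    nsmul_eq_mul, hw]
  push_cast
  ring

theorem treeSum_induction {P : Finset ℕ → Prop} (empty : P ∅)
    (insert : ∀ (m : ℕ) (s : Finset ℕ), (∀ x ∈ s, x < m) → (∀ u ⊆ s, P u) → P (insert m s))
    (s : Finset ℕ) : P s := by
  induction s using Finset.strongInduction with
  | H s ih =>
    rcases s.eq_empty_or_nonempty with rfl | hs
    · exact empty
    · rw [← Finset.insert_erase (s.max'_mem hs)]
      refine insert _ _ (fun x hx => ?_) fun u hu => ih u ?_
      · exact Finset.lt_max'_of_mem_erase_max' s hs hx
      · exact hu.trans_ssubset (Finset.erase_ssubset (s.max'_mem hs))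

theorem sum_perm_eq_treeSum (f : BinaryTree ℕ → ℚ) (n : ℕ) :
    ∑ p : Equiv.Perm (Fin n), f (ofPerm p) = treeSum f (Finset.Icc 1 n) := by
  have hinj : Function.Injective (word : Equiv.Perm (Fin n) → List ℕ) :=
    fun p q h => ofPerm_injective n (congrArg ofList h)
  have himg : Finset.univ.image (word : Equiv.Perm (Fin n) → List ℕ) =
      arrangements (Finset.Icc 1 n) := by
    apply Finset.eq_of_subset_of_card_le
    · intro l hl
      obtain ⟨p, -, rfl⟩ := Finset.mem_image.1 hl
      rw [mem_arrangements, word]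
      refine ⟨List.nodup_ofFn.2 fun i j h => ?_, ?_⟩
      · exact p.injective (Fin.ext (Nat.succ_injective h))
      · ext x
        rw [List.mem_toFinset, List.mem_ofFn, Finset.mem_Icc]
        constructor
        · rintro ⟨i, rfl⟩
          have := (p i).isLt
          omega
        · rintro ⟨h1, h2⟩
          refine ⟨p.symm ⟨x - 1, by omega⟩, ?_⟩
          simp only [Equiv.apply_symm_apply]
          omega
    · rw [card_arrangements, Finset.card_image_of_injective _ hinj, Finset.card_univ,
        Fintype.card_perm, Fintype.card_fin, Nat.card_Icc, Nat.add_sub_cancel]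
  rw [treeSum, ← himg, Finset.sum_image hinj.injOn]
  rfl

/-! ### Leaf depths and level counts, split at the root -/

theorem cons_mem_vertices_node {a : ℕ} {l r : BinaryTree ℕ} {b : Bool} {v : List Bool} :
    b :: v ∈ vertices (.node a l r) ↔ v ∈ vertices (if b then r else l) := by
  cases b <;> simp [vertices]

theorem nil_mem_vertices {t : BinaryTree ℕ} : [] ∈ vertices t ↔ t ≠ .nil := by
  cases t <;> simp [vertices]

theorem isLeaf_cons {a : ℕ} {l r : BinaryTree ℕ} {b : Bool} {v : List Bool} :
    IsLeaf (.node a l r) (b :: v) ↔ IsLeaf (if b then r else l) v := by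
  simp only [IsLeaf, List.cons_append, cons_mem_vertices_node]

theorem isLeaf_nil {a : ℕ} {l r : BinaryTree ℕ} :
    IsLeaf (.node a l r) [] ↔ l = .nil ∧ r = .nil := by
  simp [IsLeaf, cons_mem_vertices_node, nil_mem_vertices]

theorem not_isLeaf_nil (v : List Bool) : ¬IsLeaf .nil v := fun h => by
  simpa [vertices] using h.1

/-- All leaves of `t` are at distance at least `k` from the root. -/
def LeavesBelow (k : ℕ) (t : BinaryTree ℕ) : Prop :=
  ∀ v, IsLeaf t v → k ≤ v.length

theorem leavesBelow_nil (k : ℕ) : LeavesBelow k .nil := fun v h => absurd h (not_isLeaf_nil v)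

theorem leavesBelow_zero (t : BinaryTree ℕ) : LeavesBelow 0 t := fun _ _ => Nat.zero_le _

theorem leavesBelow_succ_node {k a : ℕ} {l r : BinaryTree ℕ} :
    LeavesBelow (k + 1) (.node a l r) ↔
      (LeavesBelow k l ∧ LeavesBelow k r) ∧ ¬(l = .nil ∧ r = .nil) := by
  constructor
  · intro h
    refine ⟨⟨fun v hv => ?_, fun v hv => ?_⟩, fun hn => ?_⟩
    · exact Nat.succ_le_succ_iff.1 (h (false :: v) (isLeaf_cons.2 hv))
    · exact Nat.succ_le_succ_iff.1 (h (true :: v) (isLeaf_cons.2 hv))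
    · exact absurd (h [] (isLeaf_nil.2 hn)) (by simp)
  · rintro ⟨⟨hl, hr⟩, hn⟩ v hv
    cases v with
    | nil => exact absurd (isLeaf_nil.1 hv) hn
    | cons b v =>
      have hv' := isLeaf_cons.1 hv
      cases b
      · exact Nat.succ_le_succ (hl v hv')
      · exact Nat.succ_le_succ (hr v hv')

theorem LeavesBelow.of_succ {k : ℕ} {t : BinaryTree ℕ} (h : LeavesBelow (k + 1) t) :
    LeavesBelow k t := fun v hv => (Nat.le_succ k).trans (h v hv)

theorem atLevel_nil {k : ℕ} {t : BinaryTree ℕ} :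
    AtLevel t (k + 1) [] ↔ LeavesBelow k t ∧ ¬LeavesBelow (k + 1) t := by
  simp only [AtLevel, List.nil_append]
  constructor
  · rintro ⟨⟨w, hw, he⟩, h⟩
    refine ⟨fun v hv => Nat.succ_le_succ_iff.1 (h ⟨v, hv, rfl⟩), fun h' => ?_⟩
    have := h' w hw
    omega
  · rintro ⟨h1, h2⟩
    rw [LeavesBelow] at h2
    push Not at h2
    obtain ⟨w, hw, hlt⟩ := h2
    refine ⟨⟨w, hw, ?_⟩, ?_⟩
    · have := h1 w hw
      omega
    · rintro _ ⟨v, hv, rfl⟩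
      exact Nat.succ_le_succ (h1 v hv)

theorem atLevel_cons {a k : ℕ} {l r : BinaryTree ℕ} {b : Bool} {v : List Bool} :
    AtLevel (.node a l r) k (b :: v) ↔ AtLevel (if b then r else l) k v := by
  simp only [AtLevel, List.cons_append, isLeaf_cons]

open Classical in
/-- The indicator function of `LeavesBelow`. -/
noncomputable def leavesBelowIndicator (k : ℕ) (t : BinaryTree ℕ) : ℚ :=
  if LeavesBelow k t then 1 else 0

theorem leavesBelowIndicator_nil (k : ℕ) : leavesBelowIndicator k .nil = 1 :=
  if_pos (leavesBelow_nil k)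

theorem leavesBelowIndicator_zero : leavesBelowIndicator 0 = fun _ => 1 :=
  funext fun t => if_pos (leavesBelow_zero t)

/-- The indicator function of the empty tree. -/
def nilIndicator : BinaryTree ℕ → ℚ
  | .nil => 1
  | .node _ _ _ => 0

/-- The subtracted product corrects the case of two empty subtrees: both satisfy `LeavesBelow k`
vacuously, yet the root is then a leaf at depth `0`. -/
theorem leavesBelowIndicator_succ_node (k a : ℕ) (l r : BinaryTree ℕ) :
    leavesBelowIndicator (k + 1) (.node a l r) =
      leavesBelowIndicator k l * leavesBelowIndicator k r - nilIndicator l * nilIndicator r := by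
  have h := leavesBelow_succ_node (k := k) (a := a) (l := l) (r := r)
  by_cases hl : LeavesBelow k l <;> by_cases hr : LeavesBelow k r <;>
    cases l <;> cases r <;>
    simp_all [leavesBelowIndicator, nilIndicator, leavesBelow_nil]

theorem levelCount_nil (k : ℕ) : levelCount .nil k = 0 := by
  simp [levelCount, vertices]

theorem levelCount_node (k a : ℕ) (l r : BinaryTree ℕ) :
    (levelCount (.node a l r) (k + 1) : ℚ) =
      leavesBelowIndicator k (.node a l r) - leavesBelowIndicator (k + 1) (.node a l r) +
        (levelCount l (k + 1) + levelCount r (k + 1)) := by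
  classical
  have hroot : leavesBelowIndicator k (.node a l r) - leavesBelowIndicator (k + 1) (.node a l r) =
      if AtLevel (.node a l r) (k + 1) [] then 1 else 0 := by
    simp only [atLevel_nil, leavesBelowIndicator]
    by_cases h : LeavesBelow (k + 1) (.node a l r)
    · simp [h, h.of_succ]
    · simp [h]
  have hinj : ∀ b : Bool, Function.Injective (List.cons b) := fun b => List.cons_injective
  rw [hroot]
  simp only [levelCount, vertices, Finset.card_filter]
  rw [Finset.sum_insert (by simp), Finset.sum_union, Finset.sum_image (hinj _).injOn,
    Finset.sum_image (hinj _).injOn]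
  · simp [atLevel_cons]
  · rw [Finset.disjoint_left]
    intro x hx hy
    obtain ⟨u, -, rfl⟩ := Finset.mem_image.1 hx
    obtain ⟨v, -, hv⟩ := Finset.mem_image.1 hy
    simp at hv

theorem card_vertices (t : BinaryTree ℕ) : (vertices t).card = (inorder t).length := by
  induction t with
  | nil => rfl
  | node a l r hl hr =>
    rw [vertices, Finset.card_insert_of_notMem (by simp), Finset.card_union_of_disjoint,
      Finset.card_image_of_injective _ List.cons_injective,
      Finset.card_image_of_injective _ List.cons_injective, hl, hr, inorder, List.length_append,
      List.length_cons]
    · ring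
    · rw [Finset.disjoint_left]
      intro x hx hy
      obtain ⟨u, -, rfl⟩ := Finset.mem_image.1 hx
      obtain ⟨v, -, hv⟩ := Finset.mem_image.1 hy
      simp at hv

theorem card_vertices_ofPerm {n : ℕ} (p : Equiv.Perm (Fin n)) :
    (vertices (ofPerm p)).card = n := by
  rw [card_vertices, ofPerm, inorder_ofList, word, List.length_ofFn]

/-! ### Generating functions of the level counts -/

theorem coeff_succ_eq_of_derivative {F G : ℚ⟦X⟧} (h : derivative ℚ F = G) (n : ℕ) :
    (n + 1) ! * coeff (n + 1) F = n ! * coeff n G := by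
  rw [← h, coeff_derivative, Nat.factorial_succ]
  push_cast
  ring

theorem exists_derivative_eq (G : ℚ⟦X⟧) (c : ℚ) :
    ∃ F : ℚ⟦X⟧, constantCoeff F = c ∧ derivative ℚ F = G := by
  refine ⟨mk fun n => if n = 0 then c else coeff (n - 1) G / n, ?_, ?_⟩
  · rw [← coeff_zero_eq_constantCoeff_apply, coeff_mk, if_pos rfl]
  · ext n
    rw [coeff_derivative, coeff_mk, if_neg n.succ_ne_zero, Nat.add_sub_cancel]
    have : (n : ℚ) + 1 ≠ 0 := by positivity
    push_cast
    field_simp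

theorem treeSum_nilIndicator (s : Finset ℕ) :
    treeSum nilIndicator s = s.card ! * coeff s.card (1 : ℚ⟦X⟧) := by
  induction s using treeSum_induction with
  | empty => simp [treeSum_empty, nilIndicator]
  | insert m s hm ih =>
    rw [treeSum_insert _ hm, Finset.card_insert_of_notMem fun h => (hm m h).ne rfl]
    simp [nilIndicator, pairSum, coeff_one]

theorem treeSum_one (s : Finset ℕ) :
    treeSum (fun _ => 1) s = s.card ! * coeff s.card geomSeries := by
  rw [treeSum_const, coeff_geomSeries]

theorem exists_leavesBelow_series (k : ℕ) :
    ∃ G : ℚ⟦X⟧, constantCoeff G = 1 ∧ G - geomSeries ∈ logAlgebra ∧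
      ∀ s, treeSum (leavesBelowIndicator k) s = s.card ! * coeff s.card G := by
  induction k with
  | zero =>
    refine ⟨geomSeries, ?_, ?_, fun s => ?_⟩
    · rw [← coeff_zero_eq_constantCoeff_apply, coeff_geomSeries]
    · rw [sub_self]; exact zero_mem _
    · rw [leavesBelowIndicator_zero, treeSum_one]
  | succ k ih =>
    obtain ⟨G, -, hmem, hG⟩ := ih
    obtain ⟨H, h0, hH⟩ := exists_derivative_eq (G * G - 1) 1
    refine ⟨H, h0, exists_mem_logAlgebra_of_derivative_eq hmem hH, fun s => ?_⟩
    induction s using treeSum_induction with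
    | empty => simp [treeSum_empty, leavesBelowIndicator_nil, h0]
    | insert m s hm _ =>
      rw [treeSum_insert _ hm, Finset.card_insert_of_notMem fun h => (hm m h).ne rfl,
        coeff_succ_eq_of_derivative hH]
      simp only [leavesBelowIndicator_succ_node]
      rw [pairSum_sub, pairSum_mul (fun u _ => hG u) (fun u _ => hG u),
        pairSum_mul (fun u _ => treeSum_nilIndicator u) (fun u _ => treeSum_nilIndicator u),
        map_sub, mul_sub, one_mul]

theorem exists_levelCount_series (k : ℕ) :
    ∃ F : ℚ⟦X⟧,
      (∀ s, treeSum (fun t => levelCount t (k + 1)) s = s.card ! * coeff s.card F) ∧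
      ∃ c : ℚ, Tendsto (fun n : ℕ => ((coeff n F : ℚ) : ℝ) / (n + 1)) atTop (𝓝 c) := by
  obtain ⟨G, hG0, hGmem, hG⟩ := exists_leavesBelow_series k
  obtain ⟨H, hH0, hHmem, hH⟩ := exists_leavesBelow_series (k + 1)
  obtain ⟨F, hF0, hF, hlim⟩ := exists_total_series (R := G - H)
    (by simpa using sub_mem hGmem hHmem) (by rw [map_sub, hG0, hH0, sub_self])
  refine ⟨F, fun s => ?_, hlim⟩
  induction s using treeSum_induction with
  | empty => simp [treeSum_empty, levelCount_nil, hF0]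
  | insert m s hm ih =>
    have hms : m ∉ s := fun h => (hm m h).ne rfl
    have hR : pairSum (fun l r => leavesBelowIndicator k (.node m l r) -
          leavesBelowIndicator (k + 1) (.node m l r)) s =
        s.card ! * coeff s.card (derivative ℚ (G - H)) := by
      rw [pairSum_sub, ← treeSum_insert _ hm, ← treeSum_insert _ hm, hG, hH,
        Finset.card_insert_of_notMem hms, ← mul_sub, ← map_sub, coeff_succ_eq_of_derivative rfl]
    -- Vertices of one subtree are counted once for each arrangement of the other, whence the factor
    -- `geomSeries`.
    have h1 := pairSum_mul ih (fun u _ => treeSum_one u)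
    have h2 := pairSum_mul (fun u (_ : u ⊆ s) => treeSum_one u) ih
    simp only [mul_one, one_mul] at h1 h2
    rw [treeSum_insert _ hm, Finset.card_insert_of_notMem hms, coeff_succ_eq_of_derivative hF]
    simp only [levelCount_node]
    rw [pairSum_add, pairSum_add, hR, h1, h2, mul_comm F, two_mul, map_add, map_add]
    ring

end SearchTree

theorem theorem3 (k : ℕ) (hk : 1 ≤ k) :
    ∃ c : ℚ,
      Tendsto (fun n : ℕ => (SearchTree.totalLevelCount n k : ℝ) / ((n + 1)! : ℝ))
        atTop (𝓝 (c : ℝ)) ∧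
      Tendsto (fun n : ℕ => SearchTree.levelProb n k) atTop (𝓝 (c : ℝ)) := by
  obtain ⟨k, rfl⟩ := Nat.exists_eq_succ_of_ne_zero (Nat.one_le_iff_ne_zero.1 hk)
  obtain ⟨F, hF, c, hc⟩ := SearchTree.exists_levelCount_series k
  have htotal : ∀ n, (SearchTree.totalLevelCount n (k + 1) : ℝ) =
      n ! * ((PowerSeries.coeff n F : ℚ) : ℝ) := by
    intro n
    have h := hF (Finset.Icc 1 n)
    rw [← SearchTree.sum_perm_eq_treeSum, Nat.card_Icc, Nat.add_sub_cancel] at h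
    rw [SearchTree.totalLevelCount]
    exact_mod_cast h
  refine ⟨c, hc.congr fun n => ?_, ?_⟩
  · rw [Nat.succ_eq_add_one, htotal, Nat.factorial_succ]
    have := Nat.factorial_ne_zero n
    push_cast
    field_simp
  -- The probability is the total divided by `n * n!` instead of `(n + 1)!`; the quotient of the two
  -- is `1 + 1 / n`.
  · have h := hc.mul (tendsto_one_div_atTop_nhds_zero_nat.const_add (1 : ℝ))
    rw [add_zero, mul_one] at h
    refine h.congr' ?_
    filter_upwards [eventually_ne_atTop 0] with n hn
    have hsum : SearchTree.levelProb n (k + 1) =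
        (SearchTree.totalLevelCount n (k + 1) : ℝ) / n / n ! := by
      simp only [SearchTree.levelProb, SearchTree.card_vertices_ofPerm,
        SearchTree.totalLevelCount, ← Finset.sum_div, Fintype.card_perm, Fintype.card_fin]
      push_cast
      rfl
    rw [Nat.succ_eq_add_one, hsum, htotal]
    have := Nat.factorial_ne_zero n
    field_simp
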